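/- An (abstract) operator space is a complex vector space $X$ together with a norm $\|\cdot\|_n$ on the space $\mathbb M_n(X)$ of $n\times n$ matrices over $X$ for every $n\ge 1$, such that $X\cong\mathbb M_1(X)$ is a Banach space under $\|\cdot\|_1$ and, for all $m,n\ge 1$, $x\in\mathbb M_m(X)$, $y\in\mathbb M_n(X)$ and scalar matrices $\alpha,\beta\in\mathbb M_m(\mathbb C)$, $$\left\|\begin{bmatrix}x&0\\0&y\end{bmatrix}\right\|_{m+n}=\max\{\|x\|_m,\|y\|_n\},\qquad \|\alpha x\beta\|_m\le\|\alpha\|\,\|x\|_m\,\|\beta\|,$$ where $\|\alpha\|$ and $\|\beta\|$ are the operator norms on the Hilbert space $\mathbb C^m$. A linear map $u\colon X\to Y$ of operator spaces is a complete contraction if $\|[u(x_{ij})]\|_n\le\|[x_{ij}]\|_n$ for all $n\ge 1$ and all $[x_{ij}]\in\mathbb M_n(X)$. Let $\mathbf{OS}$ be the category whose objects are the operator spaces and whose morphisms are the linear complete contractions. **Theorem.** The category $\mathbf{OS}$ is locally countably presentable (that is, locally $\aleph_1$-presentable): it is cocomplete, it has, up to isomorphism, only a small set of $\aleph_1$-presentable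 objects (objects $A$ for which $\mathbf{OS}(A,-)\colon\mathbf{OS}\to\mathbf{Set}$ preserves $\aleph_1$-directed colimits), and every object is an $\aleph_1$-directed colimit of $\aleph_1$-presentable objects. -/

import Mathlib

open CategoryTheory
open scoped Cardinal

universe u v w

/-- The matrix `α x β` for scalar matrices `α`, `β` and a matrix `x` with entries in a complex
vector space: its `(i, j)` entry is `∑ k, ∑ l, α i k β l j x k l`. -/
def Matrix.sandwich {X : Type u} [AddCommGroup X] [Module ℂ X] {n : ℕ}
    (α : Matrix (Fin n) (Fin n) ℂ) (x : Matrix (Fin n) (Fin n) X)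
    (β : Matrix (Fin n) (Fin n) ℂ) : Matrix (Fin n) (Fin n) X :=
  Matrix.of fun i j => ∑ k, ∑ l, (α i k * β l j) • x k l

/-- The block diagonal matrix `x ⊕ y`, an `(m + n) × (m + n)` matrix. -/
def Matrix.blockSum {X : Type u} [AddCommGroup X] {m n : ℕ}
    (x : Matrix (Fin m) (Fin m) X) (y : Matrix (Fin n) (Fin n) X) :
    Matrix (Fin (m + n)) (Fin (m + n)) X :=
  Matrix.reindex finSumFinEquiv finSumFinEquiv (Matrix.fromBlocks x 0 0 y)

/-- An operator space structure on a complex normed space `X`: a norm on each matrix space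
`M_n(X)` such that the norm on `M_1(X) ≅ X` is that of `X`, the norm of `x ⊕ y` is the maximum
of the norms, and `‖α x β‖ ≤ ‖α‖ ‖x‖ ‖β‖`, where scalar matrices carry the norm of operators on
the Hilbert space `ℂ^n`. The index `n = 0` is allowed for convenience; it carries no
information, since `M_0(X)` is the zero space. -/
class OperatorSpaceStructure (X : Type u) [NormedAddCommGroup X] [NormedSpace ℂ X] where
  /-- The norm on `n × n` matrices (a seminorm that is definite by the next field). -/
  matNorm (n : ℕ) : Seminorm ℂ (Matrix (Fin n) (Fin n) X)
  eq_zero_of_matNorm_eq_zero (n : ℕ) (x : Matrix (Fin n) (Fin n) X) : matNorm n x = 0 → x = 0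
  matNorm_one (x : X) : matNorm 1 (Matrix.of fun _ _ => x) = ‖x‖
  matNorm_blockSum (m n : ℕ) (x : Matrix (Fin m) (Fin m) X) (y : Matrix (Fin n) (Fin n) X) :
    matNorm (m + n) (x.blockSum y) = max (matNorm m x) (matNorm n y)
  matNorm_sandwich_le (n : ℕ) (α β : Matrix (Fin n) (Fin n) ℂ) (x : Matrix (Fin n) (Fin n) X) :
    matNorm n (α.sandwich x β) ≤
      ‖Matrix.toEuclideanCLM (n := Fin n) (𝕜 := ℂ) α‖ * matNorm n x *
        ‖Matrix.toEuclideanCLM (n := Fin n) (𝕜 := ℂ) β‖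

/-- A linear map `f` is a complete contraction if every entrywise map
`f_n : M_n(X) → M_n(Y)` is a contraction. -/
def IsCompleteContraction {X : Type u} {Y : Type v} [NormedAddCommGroup X] [NormedSpace ℂ X]
    [OperatorSpaceStructure X] [NormedAddCommGroup Y] [NormedSpace ℂ Y]
    [OperatorSpaceStructure Y] (f : X →ₗ[ℂ] Y) : Prop :=
  ∀ (n : ℕ) (x : Matrix (Fin n) (Fin n) X),
    OperatorSpaceStructure.matNorm n (x.map f) ≤ OperatorSpaceStructure.matNorm n x

/-- An (abstract) operator space: a complex Banach space with an operator space structure. -/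
structure OS : Type (u + 1) where
  carrier : Type u
  [normedAddCommGroup : NormedAddCommGroup carrier]
  [normedSpace : NormedSpace ℂ carrier]
  [completeSpace : CompleteSpace carrier]
  [operatorSpaceStructure : OperatorSpaceStructure carrier]

namespace OS

instance : CoeSort OS.{u} (Type u) := ⟨OS.carrier⟩

attribute [instance] OS.normedAddCommGroup OS.normedSpace OS.completeSpace
  OS.operatorSpaceStructure

/-- Morphisms of operator spaces: linear complete contractions. -/
@[ext]
structure Hom (X Y : OS.{u}) : Type u where
  toLinearMap : X →ₗ[ℂ] Y
  isCompleteContraction : IsCompleteContraction toLinearMap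

/-- The category of operator spaces and linear complete contractions. -/
instance : Category OS.{u} where
  Hom X Y := Hom X Y
  id X := ⟨LinearMap.id, fun _ _ => le_rfl⟩
  comp f g := ⟨g.toLinearMap.comp f.toLinearMap, fun n x =>
    (g.isCompleteContraction n (x.map f.toLinearMap)).trans (f.isCompleteContraction n x)⟩

end OS

/-- The cardinal `ℵ₁` is regular. -/
instance fact_isRegular_aleph_one : Fact (ℵ₁ : Cardinal.{w}).IsRegular :=
  ⟨Cardinal.isRegular_aleph_one⟩

/-- A category is locally countably presentable if it is locally `ℵ₁`-presentable. -/
abbrev IsLocallyCountablyPresentable (C : Type u) [Category.{v} C] : Prop :=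
  IsCardinalLocallyPresentable.{w} C ℵ₁

/-!
The category of operator spaces is cocomplete and has a small strong generator consisting of
`ℵ₁`-presentable objects; by `IsCardinalLocallyPresentable.iff_exists_isStrongGenerator` this is
equivalent to being locally `ℵ₁`-presentable.

All the operator spaces needed are completions of vector spaces `V` with a `RuanSeminorm`, a family
of seminorms on the spaces `M_n(V)` satisfying the axioms of an operator space apart from
definiteness. The entries of a matrix are dominated by its norm, which is dominated by the sum of
the norms of its entries (`RuanSeminorm.base_entry_le`, `RuanSeminorm.level_le_sum`), so the
seminorms extend continuously to matrices over the completion, and the axioms pass to the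
completion by density. The completion has the universal property `RuanSeminorm.liftHom`.

*Colimits.* On the algebraic direct sum of the values of a diagram, take the supremum of the matrix
seminorms induced by all cocones. This is finite because morphisms are contractions. Its completion
is the colimit (`OS.colimitCoconeIsColimit`).

*Generators.* The functor sending `Z` to the unit ball of `M_n(Z)` is represented by an operator
space `OS.free n`, again the completion for a supremum of seminorms. The spaces `free n` form a
strong generator (`OS.isStrongGenerator_frees`): a monomorphism that maps the unit ball of each
`M_n` onto the unit ball is injective, hence bijective with completely contractive inverse.

*Presentability.* For an `ℵ₁`-filtered diagram, the norm of a matrix over the algebraic colimit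
should be the infimum of the norms of its representatives. Since countably many elements, and
countably many equations between them, can be moved to a common stage, this infimum is attained
(`OS.exists_rep_min`), and the algebraic colimit is already complete
(`OS.surjective_algSeminorm_of`). Therefore every element of the unit ball of `M_n` of the colimit
comes from the unit ball at some stage, and two elements with the same image agree at a later
stage; this says that `free n` is `ℵ₁`-presentable (`OS.isCardinalPresentable_free`).
-/

open OperatorSpaceStructure Limits

/-! ### Matrix seminorms -/

/-- A family of seminorms on the matrix spaces `M_n(V)` of a complex vector space satisfying the
axioms of an operator space, except that it need be neither definite nor complete. -/
structure RuanSeminorm (V : Type u) [AddCommGroup V] [Module ℂ V] where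
  /-- The seminorm on `n × n` matrices. -/
  level (n : ℕ) : Seminorm ℂ (Matrix (Fin n) (Fin n) V)
  blockSum_eq (m n : ℕ) (x : Matrix (Fin m) (Fin m) V) (y : Matrix (Fin n) (Fin n) V) :
    level (m + n) (x.blockSum y) = max (level m x) (level n y)
  sandwich_le (n : ℕ) (α β : Matrix (Fin n) (Fin n) ℂ) (x : Matrix (Fin n) (Fin n) V) :
    level n (α.sandwich x β) ≤
      ‖Matrix.toEuclideanCLM (n := Fin n) (𝕜 := ℂ) α‖ * level n x *
        ‖Matrix.toEuclideanCLM (n := Fin n) (𝕜 := ℂ) β‖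

theorem Matrix.blockSum_zero_eq_single {V : Type u} [AddCommGroup V] [Module ℂ V] {n : ℕ} (v : V) :
    (Matrix.of fun _ _ : Fin 1 => v).blockSum (0 : Matrix (Fin n) (Fin n) V) =
      Matrix.single (Fin.castAdd n 0) (Fin.castAdd n 0) v := by
  ext i j
  induction i using Fin.addCases with
  | left i =>
    induction j using Fin.addCases with
    | left j => simp [Matrix.blockSum, Subsingleton.elim i 0, Subsingleton.elim j 0]
    | right j =>
      have : Fin.castAdd n (0 : Fin 1) ≠ Fin.natAdd 1 j := by simp [Fin.ext_iff]; omega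
      simp [Matrix.blockSum, this]
  | right i =>
    have : Fin.castAdd n (0 : Fin 1) ≠ Fin.natAdd 1 i := by simp [Fin.ext_iff]; omega
    induction j using Fin.addCases <;> simp [Matrix.blockSum, this]

section Matrices

variable {V : Type u} {W : Type v} [AddCommGroup V] [Module ℂ V] [AddCommGroup W] [Module ℂ W]

theorem Matrix.sandwich_map {n : ℕ} (f : V →ₗ[ℂ] W) (α β : Matrix (Fin n) (Fin n) ℂ)
    (x : Matrix (Fin n) (Fin n) V) : (α.sandwich x β).map f = α.sandwich (x.map f) β := by
  ext i j
  simp [Matrix.sandwich]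

theorem Matrix.blockSum_map {m n : ℕ} (f : V →ₗ[ℂ] W)
    (x : Matrix (Fin m) (Fin m) V) (y : Matrix (Fin n) (Fin n) V) :
    (x.blockSum y).map f = (x.map f).blockSum (y.map f) := by
  ext i j
  simp only [Matrix.blockSum, Matrix.map_apply, Matrix.reindex_apply, Matrix.submatrix_apply]
  rcases finSumFinEquiv.symm i with a | a <;> rcases finSumFinEquiv.symm j with b | b <;> simp

theorem Matrix.single_sandwich_single {n : ℕ} (x : Matrix (Fin n) (Fin n) V) (a i j b : Fin n) :
    (Matrix.single a i (1 : ℂ)).sandwich x (Matrix.single j b 1) = Matrix.single a b (x i j) := by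
  ext r c
  simp only [Matrix.sandwich, Matrix.single_apply, Matrix.of_apply]
  rw [Finset.sum_eq_single i, Finset.sum_eq_single j]
  · by_cases h₁ : a = r <;> by_cases h₂ : b = c <;> simp [h₁, h₂]
  · intro l _ hl
    simp [Ne.symm hl]
  · simp
  · intro k _ hk
    simp [Ne.symm hk]
  · simp

theorem Matrix.norm_toEuclideanCLM_single_le {n : ℕ} (i j : Fin n) :
    ‖Matrix.toEuclideanCLM (n := Fin n) (𝕜 := ℂ) (Matrix.single i j 1)‖ ≤ 1 := by
  refine ContinuousLinearMap.opNorm_le_bound _ zero_le_one fun v => ?_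
  have : Matrix.toEuclideanCLM (n := Fin n) (𝕜 := ℂ) (Matrix.single i j 1) v =
      EuclideanSpace.single i (v j) := by
    ext k
    by_cases h : k = i
    · subst h
      simp [Matrix.ofLp_toEuclideanCLM, Matrix.mulVec, dotProduct, Matrix.single_apply]
    · simp [Matrix.ofLp_toEuclideanCLM, Matrix.mulVec, dotProduct, h, Ne.symm h]
  rw [this, PiLp.norm_single, one_mul]
  exact PiLp.norm_apply_le v j

end Matrices

namespace RuanSeminorm

variable {V : Type u} [AddCommGroup V] [Module ℂ V] (p : RuanSeminorm V)

/-- The seminorm on `V ≅ M_1(V)`. -/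
noncomputable def base : Seminorm ℂ V :=
  (p.level 1).comp
    ({ toFun := fun v => Matrix.of fun _ _ => v
       map_add' := fun _ _ => rfl
       map_smul' := fun _ _ => rfl } : V →ₗ[ℂ] Matrix (Fin 1) (Fin 1) V)

theorem base_apply (v : V) : p.base v = p.level 1 (Matrix.of fun _ _ => v) := rfl

/-- Moving one entry to another position, and replacing all other entries by `0`, is a compression
by matrix units. -/
theorem level_single_le (n : ℕ) (x : Matrix (Fin n) (Fin n) V) (a i j b : Fin n) :
    p.level n (Matrix.single a b (x i j)) ≤ p.level n x := by
  rw [← Matrix.single_sandwich_single]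
  refine (p.sandwich_le _ _ _ _).trans ?_
  have h₁ := Matrix.norm_toEuclideanCLM_single_le a i
  have h₂ := Matrix.norm_toEuclideanCLM_single_le j b
  have h₃ : 0 ≤ p.level n x := apply_nonneg _ _
  calc _ ≤ 1 * p.level n x * 1 := by gcongr
    _ = _ := by ring

/-- For the first diagonal position this is the block sum axiom with `y = 0`; the other positions
reduce to it. -/
theorem level_single (n : ℕ) (a b : Fin n) (v : V) :
    p.level n (Matrix.single a b v) = p.base v := by
  obtain ⟨m, rfl⟩ : ∃ m, n = 1 + m := ⟨n - 1, by have := a.pos; omega⟩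
  have h : p.level (1 + m) (Matrix.single (Fin.castAdd m 0) (Fin.castAdd m 0) v) = p.base v := by
    rw [← Matrix.blockSum_zero_eq_single, p.blockSum_eq, map_zero, max_eq_left (apply_nonneg _ _),
      base_apply]
  rw [← h]
  apply le_antisymm
  · simpa using p.level_single_le (1 + m)
      (Matrix.single (Fin.castAdd m 0) (Fin.castAdd m 0) v) a (Fin.castAdd m 0) (Fin.castAdd m 0) b
  · simpa using p.level_single_le (1 + m)
      (Matrix.single a b v) (Fin.castAdd m 0) a b (Fin.castAdd m 0)

theorem base_entry_le (n : ℕ) (x : Matrix (Fin n) (Fin n) V) (i j : Fin n) :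
    p.base (x i j) ≤ p.level n x := by
  rw [← p.level_single n i j]
  exact p.level_single_le n x i i j j

theorem level_le_sum (n : ℕ) (x : Matrix (Fin n) (Fin n) V) :
    p.level n x ≤ ∑ i, ∑ j, p.base (x i j) := by
  conv_lhs => rw [Matrix.matrix_eq_sum_single x]
  refine (Finset.le_sum_of_subadditive _ (map_zero _).le (map_add_le_add _) _ _).trans
    (Finset.sum_le_sum fun i _ => ?_)
  refine (Finset.le_sum_of_subadditive _ (map_zero _).le (map_add_le_add _) _ _).trans
    (Finset.sum_le_sum fun j _ => ?_)
  rw [p.level_single]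

theorem norm_toEuclideanCLM_diagonal_le {n : ℕ} (d : Fin n → ℂ) (hd : ∀ i, ‖d i‖ ≤ 1) :
    ‖Matrix.toEuclideanCLM (n := Fin n) (𝕜 := ℂ) (Matrix.diagonal d)‖ ≤ 1 := by
  open scoped Matrix.Norms.L2Operator in
  rw [Matrix.l2_opNorm_toEuclideanCLM, Matrix.l2_opNorm_diagonal]
  exact (pi_norm_le_iff_of_nonneg zero_le_one).2 hd

theorem level_diagonal_sandwich_le {n : ℕ} (d : Fin n → ℂ) (hd : ∀ i, ‖d i‖ ≤ 1)
    (x : Matrix (Fin n) (Fin n) V) :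
    p.level n ((Matrix.diagonal d).sandwich x (Matrix.diagonal d)) ≤ p.level n x := by
  have h := norm_toEuclideanCLM_diagonal_le d hd
  have h₃ : 0 ≤ p.level n x := apply_nonneg _ _
  refine (p.sandwich_le _ _ _ _).trans ?_
  calc _ ≤ 1 * p.level n x * 1 := by gcongr
    _ = _ := by ring

theorem diagonal_sandwich_apply {n : ℕ} (d : Fin n → ℂ) (x : Matrix (Fin n) (Fin n) V)
    (i j : Fin n) :
    (Matrix.diagonal d).sandwich x (Matrix.diagonal d) i j = (d i * d j) • x i j := by
  simp only [Matrix.sandwich, Matrix.of_apply]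
  rw [Finset.sum_eq_single i, Finset.sum_eq_single j]
  · simp
  · intro l _ hl
    simp [Matrix.diagonal_apply_ne _ hl]
  · simp
  · intro k _ hk
    simp [Matrix.diagonal_apply_ne _ (Ne.symm hk)]
  · simp

/-- The upper left corner of a matrix is a compression by a diagonal projection. -/
theorem level_submatrix_castAdd_le (m n : ℕ) (x : Matrix (Fin (m + n)) (Fin (m + n)) V) :
    p.level m (x.submatrix (Fin.castAdd n) (Fin.castAdd n)) ≤ p.level (m + n) x := by
  have h := p.level_diagonal_sandwich_le (Fin.addCases (fun _ : Fin m => 1) (fun _ : Fin n => 0))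
    (fun i => by induction i using Fin.addCases <;> simp) x
  have h' : (Matrix.diagonal (Fin.addCases (fun _ : Fin m => 1) (fun _ : Fin n => 0))).sandwich x
      (Matrix.diagonal (Fin.addCases (fun _ : Fin m => 1) (fun _ : Fin n => 0))) =
      (x.submatrix (Fin.castAdd n) (Fin.castAdd n)).blockSum 0 := by
    ext i j
    rw [diagonal_sandwich_apply]
    induction i using Fin.addCases <;> induction j using Fin.addCases <;> simp [Matrix.blockSum]
  rw [h', p.blockSum_eq] at h
  exact (le_max_left _ _).trans h

/-- The lower right corner of a matrix is a compression by a diagonal projection. -/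
theorem level_submatrix_natAdd_le (m n : ℕ) (x : Matrix (Fin (m + n)) (Fin (m + n)) V) :
    p.level n (x.submatrix (Fin.natAdd m) (Fin.natAdd m)) ≤ p.level (m + n) x := by
  have h := p.level_diagonal_sandwich_le (Fin.addCases (fun _ : Fin m => 0) (fun _ : Fin n => 1))
    (fun i => by induction i using Fin.addCases <;> simp) x
  have h' : (Matrix.diagonal (Fin.addCases (fun _ : Fin m => 0) (fun _ : Fin n => 1))).sandwich x
      (Matrix.diagonal (Fin.addCases (fun _ : Fin m => 0) (fun _ : Fin n => 1))) =
      (0 : Matrix (Fin m) (Fin m) V).blockSum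
        (x.submatrix (Fin.natAdd m) (Fin.natAdd m)) := by
    ext i j
    rw [diagonal_sandwich_apply]
    induction i using Fin.addCases <;> induction j using Fin.addCases <;> simp [Matrix.blockSum]
  rw [h', p.blockSum_eq] at h
  exact (le_max_right _ _).trans h

end RuanSeminorm

/-! ### Completion of a matrix seminorm -/

/-- A copy of a complex vector space `E`, seminormed by `q`. -/
@[nolint unusedArguments]
def WithSeminorm {E : Type u} [AddCommGroup E] [Module ℂ E] (_q : Seminorm ℂ E) : Type u := E

namespace WithSeminorm

variable {E : Type u} [AddCommGroup E] [Module ℂ E] (q : Seminorm ℂ E)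

instance : SeminormedAddCommGroup (WithSeminorm q) :=
  AddGroupSeminorm.toSeminormedAddCommGroup (E := E) q.toAddGroupSeminorm

instance : Module ℂ (WithSeminorm q) := inferInstanceAs (Module ℂ E)

instance : NormedSpace ℂ (WithSeminorm q) where
  norm_smul_le c x := (map_smul_eq_mul q c x).le

/-- The identity map of `E`. -/
def equiv : E ≃ₗ[ℂ] WithSeminorm q := LinearEquiv.refl ℂ E

/-- The canonical map from `E` to the completion of `E` for the seminorm `q`. -/
noncomputable def toCompletion : E →ₗ[ℂ] UniformSpace.Completion (WithSeminorm q) :=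
  (UniformSpace.Completion.toComplL (𝕜 := ℂ)).toLinearMap.comp (equiv q).toLinearMap

theorem norm_toCompletion (x : E) : ‖toCompletion q x‖ = q x :=
  UniformSpace.Completion.norm_coe _

theorem denseRange_toCompletion : DenseRange (toCompletion q) :=
  UniformSpace.Completion.denseRange_coe (α := WithSeminorm q)

/-- A linear map to a Banach space that is bounded by `q` extends to the completion for `q`. -/
noncomputable def lift {F : Type v} [NormedAddCommGroup F] [NormedSpace ℂ F] [CompleteSpace F]
    (f : E →ₗ[ℂ] F) (hf : ∀ x, ‖f x‖ ≤ q x) :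
    UniformSpace.Completion (WithSeminorm q) →L[ℂ] F :=
  ((f.comp (equiv q).symm.toLinearMap).mkContinuous 1 fun x => by
    rw [one_mul]; exact hf x).fromCompletion

theorem lift_toCompletion {F : Type v} [NormedAddCommGroup F] [NormedSpace ℂ F] [CompleteSpace F]
    (f : E →ₗ[ℂ] F) (hf : ∀ x, ‖f x‖ ≤ q x) (x : E) : lift q f hf (toCompletion q x) = f x :=
  ContinuousLinearMap.fromCompletion_apply_coe _ (equiv q x)

end WithSeminorm

namespace RuanSeminorm

variable {V : Type u} [AddCommGroup V] [Module ℂ V] (p : RuanSeminorm V)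

/-- The Banach space underlying the completion of `p`: the completion of `V` for the seminorm
on `1 × 1` matrices. -/
abbrev Compl : Type u := UniformSpace.Completion (WithSeminorm p.base)

/-- The canonical map from `V` to the completion of `p`. -/
noncomputable def toCompl : V →ₗ[ℂ] p.Compl := WithSeminorm.toCompletion p.base

/-- The extension to completions of the map `V → M_n(V)` that places a vector at the entry
`(i, j)`. -/
noncomputable def singleCompl (n : ℕ) (i j : Fin n) :
    p.Compl →L[ℂ] UniformSpace.Completion (WithSeminorm (p.level n)) :=
  WithSeminorm.lift p.base
    ((WithSeminorm.toCompletion (p.level n)).comp (Matrix.singleLinearMap ℂ i j)) fun v => by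
      rw [LinearMap.comp_apply, WithSeminorm.norm_toCompletion]
      exact (p.level_single n i j v).le

theorem singleCompl_toCompl (n : ℕ) (i j : Fin n) (v : V) :
    p.singleCompl n i j (p.toCompl v) =
      WithSeminorm.toCompletion (p.level n) (Matrix.single i j v) := by
  unfold singleCompl toCompl
  rw [WithSeminorm.lift_toCompletion]
  rfl

/-- The canonical map from `M_n` of the completion of `V` to the completion of `M_n(V)`. Pulling
back the norm along this map extends `p.level n`; it is then a continuous seminorm by
construction. -/
noncomputable def matrixToCompletion (n : ℕ) :
    Matrix (Fin n) (Fin n) p.Compl →ₗ[ℂ] UniformSpace.Completion (WithSeminorm (p.level n)) :=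
  ∑ i, ∑ j, (p.singleCompl n i j).toLinearMap.comp (Matrix.entryLinearMap ℂ p.Compl i j)

theorem matrixToCompletion_apply (n : ℕ) (x : Matrix (Fin n) (Fin n) p.Compl) :
    p.matrixToCompletion n x = ∑ i, ∑ j, p.singleCompl n i j (x i j) := by
  simp [matrixToCompletion, LinearMap.sum_apply]

theorem matrixToCompletion_map (n : ℕ) (x : Matrix (Fin n) (Fin n) V) :
    p.matrixToCompletion n (x.map p.toCompl) = WithSeminorm.toCompletion (p.level n) x := by
  conv_rhs => rw [Matrix.matrix_eq_sum_single x]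
  simp only [map_sum, matrixToCompletion_apply, Matrix.map_apply, singleCompl_toCompl]

theorem continuous_matrixToCompletion (n : ℕ) : Continuous (p.matrixToCompletion n) := by
  rw [funext (p.matrixToCompletion_apply n)]
  exact continuous_finsetSum _ fun i _ => continuous_finsetSum _ fun j _ =>
    (p.singleCompl n i j).continuous.comp (continuous_id.matrix_elem i j)

/-- The extension of `p` to the completion, as a seminorm on each matrix space. -/
noncomputable def complLevel (n : ℕ) : Seminorm ℂ (Matrix (Fin n) (Fin n) p.Compl) :=
  (normSeminorm ℂ _).comp (p.matrixToCompletion n)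

theorem complLevel_map (n : ℕ) (x : Matrix (Fin n) (Fin n) V) :
    p.complLevel n (x.map p.toCompl) = p.level n x := by
  simp [complLevel, matrixToCompletion_map, WithSeminorm.norm_toCompletion]

theorem continuous_complLevel (n : ℕ) : Continuous (p.complLevel n) :=
  continuous_norm.comp (p.continuous_matrixToCompletion n)

theorem denseRange_map_toCompl (n : ℕ) :
    DenseRange fun x : Matrix (Fin n) (Fin n) V => x.map p.toCompl :=
  DenseRange.piMap fun _ => DenseRange.piMap fun _ => WithSeminorm.denseRange_toCompletion p.base

theorem continuous_blockSum {X : Type u} [AddCommGroup X] [Module ℂ X] [TopologicalSpace X]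
    (m n : ℕ) : Continuous fun z : Matrix (Fin m) (Fin m) X × Matrix (Fin n) (Fin n) X =>
      z.1.blockSum z.2 := by
  unfold Matrix.blockSum
  exact (continuous_fst.matrix_fromBlocks continuous_const continuous_const
    continuous_snd).matrix_reindex _ _

theorem continuous_sandwich {X : Type u} [NormedAddCommGroup X] [NormedSpace ℂ X]
    (n : ℕ) (α β : Matrix (Fin n) (Fin n) ℂ) :
    Continuous fun x : Matrix (Fin n) (Fin n) X => α.sandwich x β := by
  unfold Matrix.sandwich
  refine continuous_matrix fun i j => ?_
  simp only [Matrix.of_apply]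
  refine continuous_finsetSum _ fun k _ => continuous_finsetSum _ fun l _ => ?_
  exact continuous_const.smul (continuous_id.matrix_elem k l)

theorem norm_entry_le_complLevel (n : ℕ) (x : Matrix (Fin n) (Fin n) p.Compl) (i j : Fin n) :
    ‖x i j‖ ≤ p.complLevel n x := by
  induction x using (p.denseRange_map_toCompl n).induction_on with
  | hp => exact isClosed_le (continuous_id.matrix_elem i j).norm (p.continuous_complLevel n)
  | ih x =>
    rw [complLevel_map]
    exact (WithSeminorm.norm_toCompletion _ _).trans_le (p.base_entry_le n x i j)

noncomputable instance : OperatorSpaceStructure p.Compl where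
  matNorm := p.complLevel
  eq_zero_of_matNorm_eq_zero n x hx := by
    ext i j
    exact norm_le_zero_iff.1 (hx ▸ p.norm_entry_le_complLevel n x i j)
  matNorm_one x := by
    induction x using (WithSeminorm.denseRange_toCompletion p.base).induction_on with
    | hp =>
      exact isClosed_eq ((p.continuous_complLevel 1).comp
        (continuous_matrix fun _ _ => continuous_id)) continuous_norm
    | ih v =>
      rw [WithSeminorm.norm_toCompletion, base_apply, ← complLevel_map]
      rfl
  matNorm_blockSum m n x y := by
    refine isClosed_property
      ((p.denseRange_map_toCompl m).prodMap (p.denseRange_map_toCompl n))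
      (isClosed_eq ((p.continuous_complLevel _).comp (continuous_blockSum m n))
        (((p.continuous_complLevel m).comp continuous_fst).max
          ((p.continuous_complLevel n).comp continuous_snd))) (fun z => ?_) (x, y)
    simp only [Function.comp_apply, Prod.map_fst, Prod.map_snd]
    rw [← Matrix.blockSum_map, complLevel_map, complLevel_map,
      complLevel_map, p.blockSum_eq]
  matNorm_sandwich_le n α β x := by
    induction x using (p.denseRange_map_toCompl n).induction_on with
    | hp =>
      exact isClosed_le ((p.continuous_complLevel n).comp (continuous_sandwich n α β))
        ((continuous_const.mul (p.continuous_complLevel n)).mul continuous_const)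
    | ih x =>
      rw [← Matrix.sandwich_map, complLevel_map, complLevel_map]
      exact p.sandwich_le n α β x

/-- The completion of a vector space with a matrix seminorm, an operator space. -/
noncomputable def completion : OS.{u} := OS.mk p.Compl

end RuanSeminorm

/-- The matrix norms of an operator space. -/
def OS.ruanSeminorm (Z : OS.{u}) : RuanSeminorm Z where
  level := matNorm
  blockSum_eq := matNorm_blockSum
  sandwich_le := matNorm_sandwich_le

theorem OS.ruanSeminorm_base (Z : OS.{u}) (z : Z) : Z.ruanSeminorm.base z = ‖z‖ :=
  matNorm_one z

theorem OS.continuous_matNorm (Z : OS.{u}) (n : ℕ) :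
    Continuous (matNorm n : Seminorm ℂ (Matrix (Fin n) (Fin n) Z)) := by
  -- The norm on `M_n(Z)` is dominated by the continuous seminorm `x ↦ ∑ i j, ‖x i j‖`.
  rw [continuous_iff_continuousAt]
  intro x
  rw [ContinuousAt, tendsto_iff_dist_tendsto_zero]
  have hb : ∀ y, dist (matNorm n y) (matNorm n x) ≤ ∑ i, ∑ j, ‖y i j - x i j‖ := fun y => by
    refine (abs_sub_map_le_sub _ y x).trans ?_
    refine (Z.ruanSeminorm.level_le_sum n (y - x)).trans_eq ?_
    simp only [OS.ruanSeminorm_base, Matrix.sub_apply]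
  refine squeeze_zero (fun _ => dist_nonneg) hb ?_
  have : Continuous fun y : Matrix (Fin n) (Fin n) Z => ∑ i, ∑ j, ‖y i j - x i j‖ :=
    continuous_finsetSum _ fun i _ => continuous_finsetSum _ fun j _ =>
      ((continuous_id.matrix_elem i j).sub continuous_const).norm
  simpa using this.tendsto x

namespace OS

theorem norm_hom_le {X Y : OS.{u}} (f : X ⟶ Y) (x : X) : ‖f.toLinearMap x‖ ≤ ‖x‖ := by
  rw [← matNorm_one, ← matNorm_one x]
  exact f.isCompleteContraction 1 _

theorem continuous_hom {X Y : OS.{u}} (f : X ⟶ Y) : Continuous f.toLinearMap :=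
  (f.toLinearMap.mkContinuous 1 fun x => by simpa using norm_hom_le f x).continuous

@[simp] theorem id_toLinearMap (X : OS.{u}) : Hom.toLinearMap (𝟙 X) = LinearMap.id := rfl

@[simp] theorem comp_toLinearMap {X Y Z : OS.{u}} (f : X ⟶ Y) (g : Y ⟶ Z) :
    Hom.toLinearMap (f ≫ g) = g.toLinearMap.comp f.toLinearMap := rfl

theorem hom_ext {X Y : OS.{u}} {f g : X ⟶ Y} (h : ∀ x, f.toLinearMap x = g.toLinearMap x) :
    f = g :=
  Hom.ext (LinearMap.ext h)

theorem hom_congr {X Y : OS.{u}} {f g : X ⟶ Y} (h : f = g) (x : X) :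
    f.toLinearMap x = g.toLinearMap x := by rw [h]

end OS

namespace RuanSeminorm

variable {V : Type u} [AddCommGroup V] [Module ℂ V] (p : RuanSeminorm V)

/-- The canonical map from `V` to its completion. -/
noncomputable def of : V →ₗ[ℂ] p.completion := p.toCompl

theorem matNorm_map_of (n : ℕ) (x : Matrix (Fin n) (Fin n) V) :
    matNorm n (x.map p.of) = p.level n x :=
  p.complLevel_map n x

theorem norm_of (v : V) : ‖p.of v‖ = p.base v := WithSeminorm.norm_toCompletion _ _

theorem denseRange_of : DenseRange p.of := WithSeminorm.denseRange_toCompletion p.base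

theorem completion_hom_ext {Z : OS.{u}} {f g : p.completion ⟶ Z}
    (h : ∀ v, f.toLinearMap (p.of v) = g.toLinearMap (p.of v)) : f = g :=
  OS.hom_ext <| congrFun <| p.denseRange_of.equalizer (OS.continuous_hom f) (OS.continuous_hom g)
    (funext h)

/-- The universal property of the completion: a linear map from `V` to an operator space that is
completely contractive for `p` extends to the completion. -/
noncomputable def liftHom {Z : OS.{u}} (f : V →ₗ[ℂ] Z)
    (hf : ∀ n (x : Matrix (Fin n) (Fin n) V), matNorm n (x.map f) ≤ p.level n x) :
    p.completion ⟶ Z :=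
  have hf₁ : ∀ v, ‖f v‖ ≤ p.base v := fun v => (matNorm_one (f v)).symm.trans_le (hf 1 _)
  { toLinearMap := (WithSeminorm.lift p.base f hf₁).toLinearMap
    isCompleteContraction := fun n x => by
      induction x using (p.denseRange_map_toCompl n).induction_on with
      | hp =>
        refine isClosed_le ((Z.continuous_matNorm n).comp ?_) (p.continuous_complLevel n)
        exact continuous_id.matrix_map (WithSeminorm.lift p.base f hf₁).continuous
      | ih x =>
        refine Eq.trans_le ?_ ((hf n x).trans_eq (p.complLevel_map n x).symm)
        congr 1
        ext i j
        exact WithSeminorm.lift_toCompletion p.base f hf₁ (x i j) }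

theorem liftHom_of {Z : OS.{u}} (f : V →ₗ[ℂ] Z)
    (hf : ∀ n (x : Matrix (Fin n) (Fin n) V), matNorm n (x.map f) ≤ p.level n x) (v : V) :
    (p.liftHom f hf).toLinearMap (p.of v) = f v :=
  WithSeminorm.lift_toCompletion p.base f
    (fun v => (matNorm_one (f v)).symm.trans_le (hf 1 _)) v

end RuanSeminorm

/-! ### Suprema of matrix seminorms and colimits -/

namespace RuanSeminorm

variable {V : Type u} [AddCommGroup V] [Module ℂ V] {I : Type w} {Z : I → OS.{u}}
  (f : ∀ i, V →ₗ[ℂ] Z i)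

theorem bddAbove_matNorm_map (hf : ∀ v, BddAbove (Set.range fun i => ‖f i v‖)) (n : ℕ)
    (x : Matrix (Fin n) (Fin n) V) :
    BddAbove (Set.range fun i => matNorm n (x.map (f i))) := by
  choose C hC using hf
  refine ⟨∑ a, ∑ b, C (x a b), ?_⟩
  rintro _ ⟨i, rfl⟩
  refine ((Z i).ruanSeminorm.level_le_sum n (x.map (f i))).trans ?_
  refine Finset.sum_le_sum fun a _ => Finset.sum_le_sum fun b _ => ?_
  rw [OS.ruanSeminorm_base]
  exact hC (x a b) ⟨i, rfl⟩

/-- The largest matrix seminorm for which the given pointwise bounded family of linear maps to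
operator spaces consists of complete contractions. -/
noncomputable def ofFamily (hf : ∀ v, BddAbove (Set.range fun i => ‖f i v‖)) :
    RuanSeminorm V where
  level n := Seminorm.ofSMulLE (fun x => ⨆ i, matNorm n (x.map (f i)))
    (by simp [Matrix.map_zero])
    (fun x y => by
      have hx := bddAbove_matNorm_map f hf n x
      have hy := bddAbove_matNorm_map f hf n y
      refine Real.iSup_le (fun i => ?_) (add_nonneg (Real.iSup_nonneg fun i => apply_nonneg _ _)
        (Real.iSup_nonneg fun i => apply_nonneg _ _))
      rw [Matrix.map_add _ (map_add (f i))]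
      exact (map_add_le_add _ _ _).trans (add_le_add (le_ciSup hx i) (le_ciSup hy i)))
    (fun r x => by
      have hx := bddAbove_matNorm_map f hf n x
      refine Real.iSup_le (fun i => ?_) (mul_nonneg (norm_nonneg _)
        (Real.iSup_nonneg fun i => apply_nonneg _ _))
      rw [Matrix.map_smul _ _ (map_smul (f i) r), map_smul_eq_mul]
      exact mul_le_mul_of_nonneg_left (le_ciSup hx i) (norm_nonneg r))
  blockSum_eq m n x y := by
    have hx := bddAbove_matNorm_map f hf m x
    have hy := bddAbove_matNorm_map f hf n y
    have hxy := bddAbove_matNorm_map f hf (m + n) (x.blockSum y)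
    change (⨆ i, matNorm (m + n) ((x.blockSum y).map (f i))) =
      max (⨆ i, matNorm m (x.map (f i))) (⨆ i, matNorm n (y.map (f i)))
    simp only [Matrix.blockSum_map, matNorm_blockSum]
    rcases isEmpty_or_nonempty I with h | h
    · simp
    · exact ciSup_sup_eq hx hy
  sandwich_le n α β x := by
    have hx := bddAbove_matNorm_map f hf n x
    refine Real.iSup_le (fun i => ?_) (mul_nonneg (mul_nonneg (norm_nonneg _)
      (Real.iSup_nonneg fun i => apply_nonneg _ _)) (norm_nonneg _))
    rw [Matrix.sandwich_map]
    refine (matNorm_sandwich_le n α β _).trans ?_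
    gcongr
    exact le_ciSup hx i

variable (hf : ∀ v, BddAbove (Set.range fun i => ‖f i v‖))

theorem matNorm_map_le_ofFamily (i : I) (n : ℕ) (x : Matrix (Fin n) (Fin n) V) :
    matNorm n (x.map (f i)) ≤ (ofFamily f hf).level n x :=
  le_ciSup (bddAbove_matNorm_map f hf n x) i

theorem ofFamily_le {n : ℕ} {x : Matrix (Fin n) (Fin n) V} {r : ℝ} (hr : 0 ≤ r)
    (h : ∀ i, matNorm n (x.map (f i)) ≤ r) : (ofFamily f hf).level n x ≤ r :=
  Real.iSup_le h hr

end RuanSeminorm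

namespace OS

section Colimits

open scoped DirectSum

variable {J : Type u} [SmallCategory J] (F : J ⥤ OS.{u})

open Classical in
/-- The linear map from the algebraic direct sum of the values of `F` induced by a cocone. -/
noncomputable def sumDesc (s : Cocone F) : (⨁ j, F.obj j) →ₗ[ℂ] s.pt :=
  DirectSum.toModule ℂ J s.pt fun j => (s.ι.app j).toLinearMap

open Classical in
/-- The inclusion of a summand. -/
noncomputable def sumIncl (j : J) : F.obj j →ₗ[ℂ] ⨁ j, F.obj j :=
  DirectSum.lof ℂ J (fun j => F.obj j) j

theorem sumDesc_incl (s : Cocone F) (j : J) (x : F.obj j) :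
    sumDesc F s (sumIncl F j x) = (s.ι.app j).toLinearMap x := by
  classical
  exact DirectSum.toModule_lof ..

theorem bddAbove_sumDesc (v : ⨁ j, F.obj j) :
    BddAbove (Set.range fun s : Cocone F => ‖sumDesc F s v‖) := by
  classical
  induction v using DirectSum.induction_on with
  | zero => exact ⟨0, by rintro _ ⟨s, rfl⟩; simp⟩
  | of j x =>
    refine ⟨‖x‖, ?_⟩
    rintro _ ⟨s, rfl⟩
    exact (congrArg norm (sumDesc_incl F s j x)).trans_le (norm_hom_le _ x)
  | add v w hv hw =>
    obtain ⟨C, hC⟩ := hv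
    obtain ⟨D, hD⟩ := hw
    refine ⟨C + D, ?_⟩
    rintro _ ⟨s, rfl⟩
    simp only [map_add]
    exact (norm_add_le _ _).trans (add_le_add (hC ⟨s, rfl⟩) (hD ⟨s, rfl⟩))

/-- The supremum, over all cocones on `F`, of the matrix seminorms they induce on the direct sum
of the values of `F`. -/
noncomputable def sumSeminorm : RuanSeminorm (⨁ j, F.obj j) :=
  RuanSeminorm.ofFamily (sumDesc F) (bddAbove_sumDesc F)

/-- The canonical map from a value of `F` to its colimit. -/
noncomputable def colimitIncl (j : J) : F.obj j ⟶ (sumSeminorm F).completion where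
  toLinearMap := (sumSeminorm F).of.comp (sumIncl F j)
  isCompleteContraction n x := by
    have h : x.map ((sumSeminorm F).of.comp (sumIncl F j)) =
      (x.map (sumIncl F j)).map (sumSeminorm F).of := rfl
    rw [h, RuanSeminorm.matNorm_map_of]
    refine RuanSeminorm.ofFamily_le _ _ (apply_nonneg _ _) fun s => ?_
    have h' : (x.map (sumIncl F j)).map (sumDesc F s) = x.map (s.ι.app j).toLinearMap := by
      ext a b
      exact sumDesc_incl F s j (x a b)
    rw [h']
    exact (s.ι.app j).isCompleteContraction n x

/-- The completion of the direct sum for the supremum seminorm, as a cocone. Elements of the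
direct sum identified by every cocone have distance `0`, so that no algebraic quotient is taken. -/
noncomputable def colimitCocone : Cocone F where
  pt := (sumSeminorm F).completion
  ι :=
    { app := colimitIncl F
      naturality := fun j k g => by
        refine hom_ext fun x => ?_
        change (sumSeminorm F).of (sumIncl F k ((F.map g).toLinearMap x)) =
          (sumSeminorm F).of (sumIncl F j x)
        rw [← sub_eq_zero, ← map_sub, ← norm_le_zero_iff, RuanSeminorm.norm_of,
          RuanSeminorm.base_apply]
        refine RuanSeminorm.ofFamily_le _ _ le_rfl fun s => ?_
        refine (matNorm_one (sumDesc F s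
          (sumIncl F k ((F.map g).toLinearMap x) - sumIncl F j x))).trans_le ?_
        rw [map_sub, sumDesc_incl, sumDesc_incl, ← s.w g, comp_toLinearMap, LinearMap.comp_apply,
          sub_self, norm_zero] }

variable {F} in
/-- The morphism from the colimit induced by a cocone. -/
noncomputable def colimitDesc (s : Cocone F) : (sumSeminorm F).completion ⟶ s.pt :=
  (sumSeminorm F).liftHom (sumDesc F s) fun n x =>
    RuanSeminorm.matNorm_map_le_ofFamily _ _ s n x

variable {F} in
theorem colimitDesc_of (s : Cocone F) (v : ⨁ j, F.obj j) :
    (colimitDesc s).toLinearMap ((sumSeminorm F).of v) = sumDesc F s v :=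
  RuanSeminorm.liftHom_of (sumSeminorm F) (sumDesc F s) (fun n x =>
    RuanSeminorm.matNorm_map_le_ofFamily _ _ s n x) v

/-- The completion of the direct sum for the supremum seminorm is the colimit. -/
noncomputable def colimitCoconeIsColimit : IsColimit (colimitCocone F) where
  desc s := colimitDesc s
  fac s j := hom_ext fun x => (colimitDesc_of s (sumIncl F j x)).trans (sumDesc_incl F s j x)
  uniq s m hm := by
    classical
    refine RuanSeminorm.completion_hom_ext _ fun v => ?_
    refine Eq.trans ?_ (colimitDesc_of s v).symm
    have : (Hom.toLinearMap m).comp (sumSeminorm F).of = sumDesc F s := by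
      refine DirectSum.linearMap_ext ℂ fun j => LinearMap.ext fun x => ?_
      exact (hom_congr (hm j) x).trans (sumDesc_incl F s j x).symm
    exact LinearMap.congr_fun this v

instance : HasColimitsOfSize.{u, u} OS.{u} where
  has_colimits_of_shape _ _ :=
    { has_colimit := fun F => HasColimit.mk ⟨colimitCocone F, colimitCoconeIsColimit F⟩ }

end Colimits

/-! ### Operator spaces freely generated by a matrix -/

section Free

variable (n : ℕ)

/-- The vector space of formal combinations of the entries of an `n × n` matrix. -/
abbrev FreeEntries : Type u := ULift.{u} (Fin n × Fin n) →₀ ℂ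

/-- The matrix of generators. -/
noncomputable def genericMatrix : Matrix (Fin n) (Fin n) (FreeEntries.{u} n) :=
  Matrix.of fun a b => Finsupp.single ⟨(a, b)⟩ 1

/-- The linear map sending the matrix of generators to a given matrix. -/
noncomputable def evalMatrix {X : Type v} [AddCommGroup X] [Module ℂ X]
    (z : Matrix (Fin n) (Fin n) X) : FreeEntries.{u} n →ₗ[ℂ] X :=
  Finsupp.linearCombination ℂ fun t => z t.down.1 t.down.2

theorem genericMatrix_map_evalMatrix {X : Type v} [AddCommGroup X] [Module ℂ X]
    (z : Matrix (Fin n) (Fin n) X) : (genericMatrix.{u} n).map (evalMatrix n z) = z := by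
  ext a b
  simp [genericMatrix, evalMatrix]

theorem bddAbove_evalMatrix (v : FreeEntries.{u} n) :
    BddAbove (Set.range fun i : (Z : OS.{u}) × {z : Matrix (Fin n) (Fin n) Z // matNorm n z ≤ 1} =>
      ‖evalMatrix n i.2.1 v‖) := by
  refine ⟨∑ t ∈ v.support, ‖v t‖, ?_⟩
  rintro _ ⟨⟨Z, z, hz⟩, rfl⟩
  simp only [evalMatrix, Finsupp.linearCombination_apply, Finsupp.sum]
  refine (norm_sum_le _ _).trans (Finset.sum_le_sum fun t _ => ?_)
  rw [norm_smul]
  refine mul_le_of_le_one_right (norm_nonneg _) (le_trans ?_ hz)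
  rw [← ruanSeminorm_base]
  exact Z.ruanSeminorm.base_entry_le n z _ _

/-- The largest matrix seminorm for which the matrix of generators has norm at most `1`. -/
noncomputable def freeSeminorm : RuanSeminorm (FreeEntries.{u} n) :=
  RuanSeminorm.ofFamily
    (I := (Z : OS.{u}) × {z : Matrix (Fin n) (Fin n) Z // matNorm n z ≤ 1})
    (fun i => evalMatrix n i.2.1) (bddAbove_evalMatrix n)

/-- The operator space freely generated by the entries of an `n × n` matrix of norm at most `1`:
it represents the functor sending an operator space `Z` to the unit ball of `M_n(Z)`. -/
noncomputable def free : OS.{u} := (freeSeminorm.{u} n).completion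

/-- The universal matrix over `free n`. -/
noncomputable def freeMatrix : Matrix (Fin n) (Fin n) (free.{u} n) :=
  (genericMatrix.{u} n).map (freeSeminorm.{u} n).of

variable {n}

theorem matNorm_freeMatrix_le : matNorm n (freeMatrix.{u} n) ≤ 1 := by
  refine (RuanSeminorm.matNorm_map_of _ n _).trans_le ?_
  refine RuanSeminorm.ofFamily_le _ _ zero_le_one fun i => ?_
  rw [genericMatrix_map_evalMatrix]
  exact i.2.2

theorem matNorm_freeMatrix_map_le {Z : OS.{u}} (f : free.{u} n ⟶ Z) :
    matNorm n ((freeMatrix.{u} n).map f.toLinearMap) ≤ 1 :=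
  (f.isCompleteContraction n _).trans matNorm_freeMatrix_le

/-- The morphism from `free n` given by an element of the unit ball. -/
noncomputable def freeDesc {Z : OS.{u}} (z : Matrix (Fin n) (Fin n) Z) (hz : matNorm n z ≤ 1) :
    free.{u} n ⟶ Z :=
  (freeSeminorm n).liftHom (evalMatrix n z) fun m x =>
    RuanSeminorm.matNorm_map_le_ofFamily (I := (Z : OS.{u}) × {z : Matrix (Fin n) (Fin n) Z //
      matNorm n z ≤ 1}) (fun i => evalMatrix n i.2.1) (bddAbove_evalMatrix n) ⟨Z, z, hz⟩ m x

theorem freeDesc_of {Z : OS.{u}} (z : Matrix (Fin n) (Fin n) Z) (hz : matNorm n z ≤ 1)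
    (v : FreeEntries.{u} n) :
    (freeDesc z hz).toLinearMap ((freeSeminorm n).of v) = evalMatrix n z v :=
  RuanSeminorm.liftHom_of (freeSeminorm n) (evalMatrix n z) (fun m x =>
    RuanSeminorm.matNorm_map_le_ofFamily (I := (Z : OS.{u}) × {z : Matrix (Fin n) (Fin n) Z //
      matNorm n z ≤ 1}) (fun i => evalMatrix n i.2.1) (bddAbove_evalMatrix n) ⟨Z, z, hz⟩ m x) v

theorem freeMatrix_map_freeDesc {Z : OS.{u}} (z : Matrix (Fin n) (Fin n) Z)
    (hz : matNorm n z ≤ 1) : (freeMatrix.{u} n).map (freeDesc z hz).toLinearMap = z := by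
  ext a b
  refine (freeDesc_of z hz _).trans ?_
  exact congrFun (congrFun (genericMatrix_map_evalMatrix n z) a) b

theorem free_hom_ext {Z : OS.{u}} {f g : free.{u} n ⟶ Z}
    (h : (freeMatrix.{u} n).map f.toLinearMap = (freeMatrix.{u} n).map g.toLinearMap) : f = g := by
  refine RuanSeminorm.completion_hom_ext _ fun v => ?_
  have : f.toLinearMap.comp (freeSeminorm n).of = g.toLinearMap.comp (freeSeminorm n).of := by
    ext ⟨a, b⟩
    exact congrFun (congrFun h a) b
  exact LinearMap.congr_fun this v

theorem freeDesc_comp {Y Z : OS.{u}} (y : Matrix (Fin n) (Fin n) Y) (hy : matNorm n y ≤ 1)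
    (g : Y ⟶ Z) (z : Matrix (Fin n) (Fin n) Z) (hz : matNorm n z ≤ 1)
    (h : y.map g.toLinearMap = z) : freeDesc y hy ≫ g = freeDesc z hz := by
  apply free_hom_ext
  rw [freeMatrix_map_freeDesc, ← h]
  conv_rhs => rw [← freeMatrix_map_freeDesc y hy]
  rfl

end Free

/-! ### The strong generator -/

/-- The operator spaces freely generated by a square matrix. -/
def frees : ObjectProperty OS.{u} := ObjectProperty.ofObj fun n : ULift.{u} ℕ => free.{u} n.down

instance : ObjectProperty.Small.{u} frees.{u} := by
  unfold frees
  infer_instance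

theorem frees_free (n : ℕ) : frees.{u} (free.{u} n) :=
  ObjectProperty.ofObj_apply (fun n : ULift.{u} ℕ => free.{u} n.down) ⟨n⟩

theorem exists_smul_matNorm_le_one {X : OS.{u}} (x : X) :
    ∃ c : ℂ, c ≠ 0 ∧ matNorm 1 (Matrix.of fun _ _ : Fin 1 => c • x) ≤ 1 := by
  have hr : 0 < 1 + ‖x‖ := by positivity
  refine ⟨((1 + ‖x‖ : ℝ) : ℂ)⁻¹, inv_ne_zero (by exact_mod_cast hr.ne'), ?_⟩
  rw [matNorm_one, norm_smul, norm_inv, Complex.norm_of_nonneg hr.le, inv_mul_le_one₀ hr]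
  linarith

/-- Two morphisms that agree on the unit ball are equal, and the unit ball is a hom-set from
`free 1`. -/
theorem hom_ext_free {X Y : OS.{u}} {f g : X ⟶ Y} (h : ∀ t : free.{u} 1 ⟶ X, t ≫ f = t ≫ g) :
    f = g := by
  refine hom_ext fun x => ?_
  obtain ⟨c, hc, hx⟩ := exists_smul_matNorm_le_one x
  have h₁ := h (freeDesc _ hx)
  have h₂ : ∀ k : X ⟶ Y, (freeMatrix.{u} 1).map (freeDesc _ hx ≫ k).toLinearMap =
      (Matrix.of fun _ _ : Fin 1 => c • x).map k.toLinearMap := fun k => by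
    conv_rhs => rw [← freeMatrix_map_freeDesc _ hx]
    rfl
  have h₃ := congrFun (congrFun ((h₂ f).symm.trans ((congrArg (fun k : free.{u} 1 ⟶ Y =>
    (freeMatrix.{u} 1).map k.toLinearMap) h₁).trans (h₂ g))) 0) 0
  simpa only [Matrix.map_apply, Matrix.of_apply, map_smul, smul_right_inj hc] using h₃

/-- Surjectivity on the hom-sets from `free n` says that `i` maps the unit ball of `M_n(X)` onto
that of `M_n(Y)` for every `n`; a bijection `i` with this property has a completely contractive
inverse. -/
theorem isIso_of_surjective_frees {X Y : OS.{u}} (i : X ⟶ Y) [Mono i]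
    (hi : ∀ n, Function.Surjective fun f : free.{u} n ⟶ X => f ≫ i) : IsIso i := by
  -- Every matrix over `Y` of norm at most `1` is the image of one over `X`; rescale.
  have key : ∀ (n : ℕ) (y : Matrix (Fin n) (Fin n) Y) (r : ℝ), matNorm n y < r →
      ∃ x : Matrix (Fin n) (Fin n) X, x.map i.toLinearMap = y ∧ matNorm n x ≤ r := by
    intro n y r hr
    have hr0 : 0 < r := (apply_nonneg _ _).trans_lt hr
    have hr' : (r : ℂ) ≠ 0 := by simpa using hr0.ne'
    have hy : matNorm n ((r⁻¹ : ℂ) • y) ≤ 1 := by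
      rw [map_smul_eq_mul, norm_inv, Complex.norm_of_nonneg hr0.le, inv_mul_le_one₀ hr0]
      exact hr.le
    obtain ⟨f, hf⟩ := hi n (freeDesc _ hy)
    refine ⟨(r : ℂ) • (freeMatrix.{u} n).map f.toLinearMap, ?_, ?_⟩
    · have h₁ : ((freeMatrix.{u} n).map f.toLinearMap).map i.toLinearMap = (r⁻¹ : ℂ) • y := by
        rw [← freeMatrix_map_freeDesc _ hy, ← hf]
        rfl
      rw [Matrix.map_smul _ _ (map_smul i.toLinearMap (r : ℂ)), h₁, smul_inv_smul₀ hr']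
    · rw [map_smul_eq_mul, Complex.norm_of_nonneg hr0.le]
      exact mul_le_of_le_one_right hr0.le (matNorm_freeMatrix_map_le f)
  have hsurj : Function.Surjective i.toLinearMap := fun y => by
    obtain ⟨x, hx, -⟩ := key 1 (Matrix.of fun _ _ => y) _ (lt_add_one _)
    exact ⟨x 0 0, congrFun (congrFun hx 0) 0⟩
  have hinj : Function.Injective i.toLinearMap := by
    rw [injective_iff_map_eq_zero]
    intro x hx
    -- A multiple of `x` in the unit ball and `0` define morphisms `free 1 ⟶ X` equalized by `i`.
    obtain ⟨c, hc, hx₁⟩ := exists_smul_matNorm_le_one x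
    have h0 : ∀ W : OS.{u}, matNorm 1 (0 : Matrix (Fin 1) (Fin 1) W) ≤ 1 := fun W => by
      rw [map_zero]; exact zero_le_one
    have h : freeDesc _ hx₁ = freeDesc 0 (h0 X) := by
      rw [← cancel_mono i, freeDesc_comp _ _ i 0 (h0 Y), freeDesc_comp _ _ i 0 (h0 Y)]
      · ext; simp
      · ext; simp [hx]
    have h₁ := freeMatrix_map_freeDesc _ hx₁
    rw [h, freeMatrix_map_freeDesc] at h₁
    have h₂ := congrFun (congrFun h₁ 0) 0
    simpa [hc] using h₂.symm
  let e := LinearEquiv.ofBijective i.toLinearMap ⟨hinj, hsurj⟩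
  have he : ∀ x, e.symm (i.toLinearMap x) = x := e.symm_apply_apply
  let j : Y ⟶ X :=
    { toLinearMap := e.symm.toLinearMap
      isCompleteContraction := fun n y => by
        refine le_of_forall_gt_imp_ge_of_dense fun r hr => ?_
        obtain ⟨x, rfl, hx⟩ := key n y r hr
        refine le_trans (le_of_eq ?_) hx
        congr 1
        ext a b
        exact he (x a b) }
  exact ⟨j, hom_ext he, hom_ext fun y => e.apply_symm_apply y⟩

theorem isStrongGenerator_frees : frees.{u}.IsStrongGenerator := by
  rw [ObjectProperty.isStrongGenerator_iff]
  refine ⟨fun X Y f g h => hom_ext_free fun t => h _ (frees_free 1) t, fun X Y i _ hi => ?_⟩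
  exact isIso_of_surjective_frees i fun n => hi _ (frees_free n)

end OS

/-! ### Colimits over `ℵ₁`-filtered categories -/

theorem hasCardinalLT_aleph_one_of_countable (ι : Type v) [Countable ι] :
    HasCardinalLT ι (ℵ₁ : Cardinal.{w}) := by
  rw [HasCardinalLT]
  calc Cardinal.lift.{w} (Cardinal.mk ι) ≤ ℵ₀ := by simp
    _ < ℵ₁ := Cardinal.aleph0_lt_aleph_one
    _ = Cardinal.lift.{v} (ℵ₁ : Cardinal.{w}) := by simp

namespace OS

/-- The underlying complex vector space of an operator space. -/
def toModuleCat : OS.{u} ⥤ ModuleCat.{u} ℂ where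
  obj Z := ModuleCat.of ℂ Z
  map f := ModuleCat.ofHom f.toLinearMap

/-- The library instance for filtered colimits of modules asks the ring to live in the universe of
the modules, whereas `ℂ : Type`; the forgetful functor to abelian groups has no such restriction. -/
theorem preservesColimit_forget_moduleCat {J : Type u} [SmallCategory J] [IsFiltered J]
    (G : J ⥤ ModuleCat.{u} ℂ) : PreservesColimit G (forget (ModuleCat.{u} ℂ)) := by
  change PreservesColimit G
    (forget₂ (ModuleCat.{u} ℂ) AddCommGrpCat.{u} ⋙ forget AddCommGrpCat.{u})
  infer_instance

section AlgebraicColimit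

variable {J : Type u} [SmallCategory J] (F : J ⥤ OS.{u})

/-- The colimit of the underlying vector spaces. -/
noncomputable abbrev AlgColimit : Type u := (colimit (F ⋙ toModuleCat) : ModuleCat.{u} ℂ)

/-- The canonical map to the colimit of the underlying vector spaces. -/
noncomputable def algIncl (j : J) : F.obj j →ₗ[ℂ] AlgColimit F :=
  (colimit.ι (F ⋙ toModuleCat) j).hom

theorem algIncl_map {j k : J} (g : j ⟶ k) (x : F.obj j) :
    algIncl F k ((F.map g).toLinearMap x) = algIncl F j x := by
  have := colimit.w (F ⋙ toModuleCat) g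
  exact LinearMap.congr_fun (congrArg ModuleCat.Hom.hom this) x

theorem map_algIncl_map {j k : J} (g : j ⟶ k) {n : ℕ} (x : Matrix (Fin n) (Fin n) (F.obj j)) :
    (x.map (F.map g).toLinearMap).map (algIncl F k) = x.map (algIncl F j) := by
  ext a b
  exact algIncl_map F g (x a b)

theorem map_comp_apply {i j k : J} (g : i ⟶ j) (h : j ⟶ k) (x : F.obj i) :
    (F.map (g ≫ h)).toLinearMap x = (F.map h).toLinearMap ((F.map g).toLinearMap x) := by
  rw [F.map_comp]
  rfl

theorem matNorm_map_le {j k : J} (g : j ⟶ k) {n : ℕ} (x : Matrix (Fin n) (Fin n) (F.obj j)) :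
    matNorm n (x.map (F.map g).toLinearMap) ≤ matNorm n x :=
  (F.map g).isCompleteContraction n x

/-- The linear map from the colimit of the underlying vector spaces induced by a cocone. -/
noncomputable def algDesc (s : Cocone F) : AlgColimit F →ₗ[ℂ] s.pt :=
  (colimit.desc (F ⋙ toModuleCat) (toModuleCat.mapCocone s)).hom

theorem algDesc_algIncl (s : Cocone F) (j : J) (x : F.obj j) :
    algDesc F s (algIncl F j x) = (s.ι.app j).toLinearMap x :=
  LinearMap.congr_fun (congrArg ModuleCat.Hom.hom
    (colimit.ι_desc (toModuleCat.mapCocone s) j)) x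

variable [IsCardinalFiltered J (ℵ₁ : Cardinal.{u})]

theorem exists_rep (a : AlgColimit F) : ∃ (j : J) (x : F.obj j), algIncl F j x = a := by
  have := isFiltered_of_isCardinalFiltered J (ℵ₁ : Cardinal.{u})
  have := preservesColimit_forget_moduleCat (F ⋙ toModuleCat)
  exact Concrete.colimit_exists_rep (F ⋙ toModuleCat) a

theorem exists_map_eq {j : J} (x y : F.obj j) (h : algIncl F j x = algIncl F j y) :
    ∃ (k : J) (g : j ⟶ k), (F.map g).toLinearMap x = (F.map g).toLinearMap y := by
  have := isFiltered_of_isCardinalFiltered J (ℵ₁ : Cardinal.{u})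
  have := preservesColimit_forget_moduleCat (F ⋙ toModuleCat)
  obtain ⟨k, g, g', hg⟩ := Concrete.colimit_exists_of_rep_eq (F ⋙ toModuleCat) x y h
  refine ⟨IsFiltered.coeq g g', g ≫ IsFiltered.coeqHom g g', ?_⟩
  conv_rhs => rw [IsFiltered.coeq_condition]
  rw [map_comp_apply, map_comp_apply]
  exact congrArg _ hg

variable {F}

/-- Countably many elements of the colimit are represented at a common stage. -/
theorem exists_rep_family {ι : Type} [Countable ι] (a : ι → AlgColimit F) :
    ∃ (j : J) (x : ι → F.obj j), ∀ t, algIncl F j (x t) = a t := by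
  choose j x hx using fun t => exists_rep F (a t)
  have hι := hasCardinalLT_aleph_one_of_countable.{0, u} ι
  refine ⟨IsCardinalFiltered.max j hι,
    fun t => (F.map (IsCardinalFiltered.toMax j hι t)).toLinearMap (x t), fun t => ?_⟩
  rw [algIncl_map, hx]

/-- Countably many equalities in the colimit hold at a common stage. -/
theorem exists_map_eq_family {ι : Type} [Countable ι] {j : J} (x y : ι → F.obj j)
    (h : ∀ t, algIncl F j (x t) = algIncl F j (y t)) :
    ∃ (k : J) (g : j ⟶ k), ∀ t, (F.map g).toLinearMap (x t) = (F.map g).toLinearMap (y t) := by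
  choose k g hg using fun t => exists_map_eq F (x t) (y t) (h t)
  obtain ⟨m, a, b, hab⟩ := IsCardinalFiltered.wideSpan g
    (hasCardinalLT_aleph_one_of_countable.{0, u} ι)
  refine ⟨m, b, fun t => ?_⟩
  rw [← hab t, map_comp_apply, map_comp_apply, hg]

theorem exists_matrix_rep {n : ℕ} (y : Matrix (Fin n) (Fin n) (AlgColimit F)) :
    ∃ (j : J) (x : Matrix (Fin n) (Fin n) (F.obj j)), x.map (algIncl F j) = y := by
  obtain ⟨j, x, hx⟩ := exists_rep_family fun t : Fin n × Fin n => y t.1 t.2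
  exact ⟨j, Matrix.of fun a b => x (a, b), Matrix.ext fun a b => hx (a, b)⟩

theorem exists_matrix_map_eq {n : ℕ} {j : J} (x y : Matrix (Fin n) (Fin n) (F.obj j))
    (h : x.map (algIncl F j) = y.map (algIncl F j)) :
    ∃ (k : J) (g : j ⟶ k), x.map (F.map g).toLinearMap = y.map (F.map g).toLinearMap := by
  obtain ⟨k, g, hg⟩ := exists_map_eq_family (fun t : Fin n × Fin n => x t.1 t.2)
    (fun t => y t.1 t.2) fun t => congrFun (congrFun h t.1) t.2
  exact ⟨k, g, Matrix.ext fun a b => hg (a, b)⟩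

/-- Among the matrices representing a matrix over the algebraic colimit there is one of least
norm: a minimizing sequence of representatives becomes constant at a common stage. -/
theorem exists_rep_min {n : ℕ} (y : Matrix (Fin n) (Fin n) (AlgColimit F)) :
    ∃ (j : J) (x : Matrix (Fin n) (Fin n) (F.obj j)), x.map (algIncl F j) = y ∧
      ∀ (k : J) (x' : Matrix (Fin n) (Fin n) (F.obj k)), x'.map (algIncl F k) = y →
        matNorm n x ≤ matNorm n x' := by
  set S : Set ℝ := {r | ∃ (j : J) (x : Matrix (Fin n) (Fin n) (F.obj j)),
    x.map (algIncl F j) = y ∧ matNorm n x = r}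
  have hS : S.Nonempty := by
    obtain ⟨j, x, hx⟩ := exists_matrix_rep y
    exact ⟨_, j, x, hx, rfl⟩
  have hb : BddBelow S := ⟨0, by rintro _ ⟨j, x, -, rfl⟩; exact apply_nonneg _ _⟩
  have hseq : ∀ i : ℕ, ∃ (j : J) (x : Matrix (Fin n) (Fin n) (F.obj j)),
      x.map (algIncl F j) = y ∧ matNorm n x < sInf S + 1 / ((i : ℝ) + 1) := fun i => by
    obtain ⟨_, ⟨j, x, hx, rfl⟩, h⟩ := exists_lt_of_csInf_lt hS
      (lt_add_of_pos_right (sInf S) (Nat.one_div_pos_of_nat (α := ℝ) (n := i)))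
    exact ⟨j, x, hx, h⟩
  choose j x hx hlt using hseq
  have hι := hasCardinalLT_aleph_one_of_countable.{0, u} ℕ
  let x' (i : ℕ) := (x i).map (F.map (IsCardinalFiltered.toMax j hι i)).toLinearMap
  have hx' : ∀ i, (x' i).map (algIncl F _) = y := fun i => (map_algIncl_map F _ _).trans (hx i)
  obtain ⟨k, g, hg⟩ := exists_map_eq_family
    (fun t : ℕ × Fin n × Fin n => x' t.1 t.2.1 t.2.2) (fun t => x' 0 t.2.1 t.2.2)
    fun t => congrFun (congrFun ((hx' t.1).trans (hx' 0).symm) t.2.1) t.2.2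
  refine ⟨k, (x' 0).map (F.map g).toLinearMap, (map_algIncl_map F _ _).trans (hx' 0), ?_⟩
  intro k' w hw
  refine le_trans ?_ (csInf_le hb ⟨k', w, hw, rfl⟩)
  have hle : ∀ i : ℕ, matNorm n ((x' 0).map (F.map g).toLinearMap) ≤
      sInf S + 1 / ((i : ℝ) + 1) := fun i => by
    have h₁ : (x' 0).map (F.map g).toLinearMap = (x' i).map (F.map g).toLinearMap :=
      Matrix.ext fun a b => (hg (i, a, b)).symm
    rw [h₁]
    exact (matNorm_map_le F _ _).trans ((matNorm_map_le F _ _).trans (hlt i).le)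
  have hlim := tendsto_one_div_add_atTop_nhds_zero_nat (𝕜 := ℝ).const_add (sInf S)
  rw [add_zero] at hlim
  exact ge_of_tendsto' hlim hle

variable (F) in
/-- The least norm of a matrix representing a given matrix over the algebraic colimit. -/
noncomputable def algNorm (n : ℕ) (y : Matrix (Fin n) (Fin n) (AlgColimit F)) : ℝ :=
  matNorm n (exists_rep_min y).choose_spec.choose

theorem exists_rep_matNorm_eq {n : ℕ} (y : Matrix (Fin n) (Fin n) (AlgColimit F)) :
    ∃ (j : J) (x : Matrix (Fin n) (Fin n) (F.obj j)), x.map (algIncl F j) = y ∧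
      matNorm n x = algNorm F n y :=
  ⟨_, _, (exists_rep_min y).choose_spec.choose_spec.1, rfl⟩

theorem algNorm_le {n : ℕ} {j : J} {x : Matrix (Fin n) (Fin n) (F.obj j)}
    {y : Matrix (Fin n) (Fin n) (AlgColimit F)} (h : x.map (algIncl F j) = y) :
    algNorm F n y ≤ matNorm n x :=
  (exists_rep_min y).choose_spec.choose_spec.2 j x h

/-- Two matrices over the algebraic colimit have representatives of least norm at a common
stage. -/
theorem exists_rep_matNorm_le_pair {m n : ℕ} (y : Matrix (Fin m) (Fin m) (AlgColimit F))
    (z : Matrix (Fin n) (Fin n) (AlgColimit F)) :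
    ∃ (j : J) (x : Matrix (Fin m) (Fin m) (F.obj j)) (w : Matrix (Fin n) (Fin n) (F.obj j)),
      x.map (algIncl F j) = y ∧ w.map (algIncl F j) = z ∧
        matNorm m x ≤ algNorm F m y ∧ matNorm n w ≤ algNorm F n z := by
  have := isFiltered_of_isCardinalFiltered J (ℵ₁ : Cardinal.{u})
  obtain ⟨j, x, hx, hx'⟩ := exists_rep_matNorm_eq y
  obtain ⟨k, w, hw, hw'⟩ := exists_rep_matNorm_eq z
  exact ⟨IsFiltered.max j k, x.map (F.map (IsFiltered.leftToMax j k)).toLinearMap,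
    w.map (F.map (IsFiltered.rightToMax j k)).toLinearMap,
    (map_algIncl_map F _ _).trans hx, (map_algIncl_map F _ _).trans hw,
    (matNorm_map_le F _ _).trans hx'.le, (matNorm_map_le F _ _).trans hw'.le⟩

variable (F) in
/-- The least norms of representatives form a matrix seminorm on the algebraic colimit. -/
noncomputable def algSeminorm : RuanSeminorm (AlgColimit F) where
  level n := Seminorm.ofSMulLE (algNorm F n)
    (by
      have := isFiltered_of_isCardinalFiltered J (ℵ₁ : Cardinal.{u})
      obtain ⟨j⟩ := IsFiltered.nonempty (C := J)
      refine le_antisymm ?_ (apply_nonneg _ _)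
      exact (algNorm_le (j := j) (x := 0) (by ext; simp)).trans_eq (map_zero _))
    (fun y z => by
      obtain ⟨j, x, w, hx, hw, hxn, hwn⟩ := exists_rep_matNorm_le_pair y z
      refine (algNorm_le (x := x + w) ?_).trans
        ((map_add_le_add _ _ _).trans (add_le_add hxn hwn))
      rw [Matrix.map_add _ (map_add (algIncl F j)), hx, hw])
    (fun r y => by
      obtain ⟨j, x, hx, hxn⟩ := exists_rep_matNorm_eq y
      rw [← hxn, ← map_smul_eq_mul]
      refine algNorm_le ?_
      rw [Matrix.map_smul _ _ (map_smul (algIncl F j) r), hx])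
  blockSum_eq m n y z := by
    apply le_antisymm
    · obtain ⟨j, x, w, hx, hw, hxn, hwn⟩ := exists_rep_matNorm_le_pair y z
      refine (algNorm_le (x := x.blockSum w) ?_).trans
        ((matNorm_blockSum _ _ _ _).trans_le (max_le_max hxn hwn))
      rw [Matrix.blockSum_map, hx, hw]
    · obtain ⟨j, w, hw, hwn⟩ := exists_rep_matNorm_eq (y.blockSum z)
      refine le_trans ?_ hwn.le
      refine max_le ?_ ?_
      · refine le_trans ?_ ((F.obj j).ruanSeminorm.level_submatrix_castAdd_le m n w)
        refine algNorm_le (Matrix.ext fun a b => ?_)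
        refine (congrFun (congrFun hw (Fin.castAdd n a)) (Fin.castAdd n b)).trans ?_
        simp [Matrix.blockSum]
      · refine le_trans ?_ ((F.obj j).ruanSeminorm.level_submatrix_natAdd_le m n w)
        refine algNorm_le (Matrix.ext fun a b => ?_)
        refine (congrFun (congrFun hw (Fin.natAdd m a)) (Fin.natAdd m b)).trans ?_
        simp [Matrix.blockSum]
  sandwich_le n α β y := by
    obtain ⟨j, x, hx, hxn⟩ := exists_rep_matNorm_eq y
    refine (algNorm_le (x := α.sandwich x β) ?_).trans
      ((matNorm_sandwich_le n α β x).trans_eq ?_)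
    · rw [Matrix.sandwich_map, hx]
    · rw [hxn]
      rfl

theorem algSeminorm_level (n : ℕ) (y : Matrix (Fin n) (Fin n) (AlgColimit F)) :
    (algSeminorm F).level n y = algNorm F n y := rfl

/-- The norm of the image of a matrix in the colimit is attained at some stage. -/
theorem exists_matNorm_map_le {n : ℕ} {j : J} (x : Matrix (Fin n) (Fin n) (F.obj j)) :
    ∃ (k : J) (g : j ⟶ k), matNorm n (x.map (F.map g).toLinearMap) ≤
      algNorm F n (x.map (algIncl F j)) := by
  have := isFiltered_of_isCardinalFiltered J (ℵ₁ : Cardinal.{u})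
  obtain ⟨k, w, hw, hwn⟩ := exists_rep_matNorm_eq (x.map (algIncl F j))
  obtain ⟨l, g, hg⟩ := exists_matrix_map_eq
    (x.map (F.map (IsFiltered.leftToMax j k)).toLinearMap)
    (w.map (F.map (IsFiltered.rightToMax j k)).toLinearMap)
    ((map_algIncl_map F _ _).trans (hw.symm.trans (map_algIncl_map F _ _).symm))
  refine ⟨l, IsFiltered.leftToMax j k ≫ g, ?_⟩
  have h : x.map (F.map (IsFiltered.leftToMax j k ≫ g)).toLinearMap =
      (w.map (F.map (IsFiltered.rightToMax j k)).toLinearMap).map (F.map g).toLinearMap := by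
    rw [← hg]
    exact Matrix.ext fun a b => map_comp_apply F _ _ (x a b)
  rw [h, ← hwn]
  exact (matNorm_map_le F _ _).trans (matNorm_map_le F _ _)

end AlgebraicColimit

section FilteredColimit

variable {J : Type u} [SmallCategory J] [IsCardinalFiltered J (ℵ₁ : Cardinal.{u})]
  (F : J ⥤ OS.{u})

/-- The completion of the algebraic colimit, as a cocone. -/
noncomputable def filteredCocone : Cocone F where
  pt := (algSeminorm F).completion
  ι :=
    { app := fun j =>
        { toLinearMap := (algSeminorm F).of.comp (algIncl F j)
          isCompleteContraction := fun n x =>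
            ((algSeminorm F).matNorm_map_of n (x.map (algIncl F j))).trans_le (algNorm_le rfl) }
      naturality := fun _ _ g => hom_ext fun x =>
        congrArg (algSeminorm F).of (algIncl_map F g x) }

variable {F} in
theorem matNorm_map_algDesc_le (s : Cocone F) (n : ℕ)
    (y : Matrix (Fin n) (Fin n) (AlgColimit F)) :
    matNorm n (y.map (algDesc F s)) ≤ (algSeminorm F).level n y := by
  obtain ⟨j, x, rfl, hxn⟩ := exists_rep_matNorm_eq y
  rw [algSeminorm_level, ← hxn]
  have h : (x.map (algIncl F j)).map (algDesc F s) = x.map (s.ι.app j).toLinearMap :=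
    Matrix.ext fun a b => algDesc_algIncl F s j (x a b)
  rw [h]
  exact (s.ι.app j).isCompleteContraction n x

/-- The completion of the algebraic colimit is the colimit. -/
noncomputable def filteredCoconeIsColimit : IsColimit (filteredCocone F) where
  desc s := (algSeminorm F).liftHom (algDesc F s) (matNorm_map_algDesc_le s)
  fac s j := hom_ext fun x =>
    ((algSeminorm F).liftHom_of (algDesc F s) (matNorm_map_algDesc_le s) (algIncl F j x)).trans
      (algDesc_algIncl F s j x)
  uniq s m hm := by
    refine RuanSeminorm.completion_hom_ext _ fun a => ?_
    obtain ⟨j, x, rfl⟩ := exists_rep F a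
    refine Eq.trans (hom_congr (hm j) x) (Eq.symm ?_)
    exact ((algSeminorm F).liftHom_of (algDesc F s) (matNorm_map_algDesc_le s)
      (algIncl F j x)).trans (algDesc_algIncl F s j x)

variable {F}

/-- The algebraic colimit is already complete: a convergent sequence lifts to some stage, and
at a later stage all the countably many distances between its terms are those in the colimit. -/
theorem surjective_algSeminorm_of : Function.Surjective (algSeminorm F).of := by
  intro z
  obtain ⟨s, hs, hlim⟩ := mem_closure_iff_seq_limit.1 ((algSeminorm F).denseRange_of z)
  choose a ha using hs
  obtain ⟨j, x, hx⟩ := exists_rep_family a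
  have hd : ∀ t : ℕ × ℕ, ∃ (k : J) (g : j ⟶ k),
      ‖(F.map g).toLinearMap (x t.1 - x t.2)‖ ≤ ‖s t.1 - s t.2‖ := fun t => by
    obtain ⟨k, g, hg⟩ := exists_matNorm_map_le (Matrix.of fun _ _ : Fin 1 => x t.1 - x t.2)
    refine ⟨k, g, (matNorm_one _).symm.trans_le (hg.trans_eq ?_)⟩
    rw [← ha, ← ha, ← map_sub, RuanSeminorm.norm_of, ← hx, ← hx, ← map_sub]
    rfl
  choose k g hg using hd
  obtain ⟨m, c, b, hcb⟩ := IsCardinalFiltered.wideSpan g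
    (hasCardinalLT_aleph_one_of_countable.{0, u} (ℕ × ℕ))
  let w (i : ℕ) : F.obj m := (F.map b).toLinearMap (x i)
  have hw : ∀ i l, dist (w i) (w l) ≤ dist (s i) (s l) := fun i l => by
    rw [dist_eq_norm, dist_eq_norm]
    refine le_trans ?_ (hg (i, l))
    simp only [w, ← map_sub]
    rw [← hcb (i, l), map_comp_apply]
    exact norm_hom_le _ _
  have hcauchy : CauchySeq w := by
    rw [Metric.cauchySeq_iff]
    intro ε hε
    obtain ⟨N, hN⟩ := Metric.cauchySeq_iff.1 hlim.cauchySeq ε hε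
    exact ⟨N, fun i hi l hl => (hw i l).trans_lt (hN i hi l hl)⟩
  obtain ⟨y, hy⟩ := cauchySeq_tendsto_of_complete hcauchy
  refine ⟨algIncl F m y, tendsto_nhds_unique (f := s) (l := Filter.atTop) ?_ hlim⟩
  have hc := (continuous_hom ((filteredCocone F).ι.app m)).tendsto y
  refine (hc.comp hy).congr fun i => ?_
  rw [← ha, ← hx, ← algIncl_map F b (x i)]
  rfl

end FilteredColimit

/-! ### Presentability of the generators -/

theorem eq_freeDesc {n : ℕ} {Z : OS.{u}} (f : free.{u} n ⟶ Z) :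
    f = freeDesc ((freeMatrix.{u} n).map f.toLinearMap) (matNorm_freeMatrix_map_le f) :=
  free_hom_ext (freeMatrix_map_freeDesc _ _).symm

theorem isCardinalPresentable_free (n : ℕ) :
    IsCardinalPresentable (free.{u} n) (ℵ₁ : Cardinal.{u}) where
  preservesColimitOfShape J _ _ := by
    have := isFiltered_of_isCardinalFiltered J (ℵ₁ : Cardinal.{u})
    refine ⟨fun {F} => preservesColimit_of_preserves_colimit_cocone (filteredCoconeIsColimit F)
      (Types.FilteredColimit.isColimitOf' _ _ ?_ ?_)⟩
    · intro (f : free.{u} n ⟶ (algSeminorm F).completion)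
      -- The matrix classified by `f` comes from a matrix of norm at most `1` at some stage.
      set z := (freeMatrix.{u} n).map f.toLinearMap with hz
      choose y hy using fun a b => surjective_algSeminorm_of (F := F) (z a b)
      obtain ⟨j, x, hx, hxn⟩ := exists_rep_matNorm_eq (Matrix.of y)
      have hyz : (Matrix.of y).map (algSeminorm F).of = z := Matrix.ext hy
      have hx1 : matNorm n x ≤ 1 := by
        rw [hxn, ← algSeminorm_level, ← RuanSeminorm.matNorm_map_of, hyz]
        exact matNorm_freeMatrix_map_le f
      refine ⟨j, freeDesc x hx1, ?_⟩
      refine (eq_freeDesc f).trans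
        (freeDesc_comp x hx1 ((filteredCocone F).ι.app j) _ _ ?_).symm
      rw [← hz, ← hyz, ← hx]
      rfl
    · intro j (f : free.{u} n ⟶ F.obj j) (g : free.{u} n ⟶ F.obj j)
        (h : f ≫ (filteredCocone F).ι.app j = g ≫ (filteredCocone F).ι.app j)
      -- The difference of the two matrices has norm `0` in the colimit, hence at some stage.
      set x := (freeMatrix.{u} n).map f.toLinearMap - (freeMatrix.{u} n).map g.toLinearMap with hx
      have h0 : (x.map (algIncl F j)).map (algSeminorm F).of = 0 := by
        ext a b
        have := hom_congr h (freeMatrix.{u} n a b)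
        simp only [hx, Matrix.map_apply, Matrix.sub_apply, map_sub, Matrix.zero_apply]
        exact sub_eq_zero.2 this
      obtain ⟨k, t, ht⟩ := exists_matNorm_map_le x
      rw [← algSeminorm_level, ← RuanSeminorm.matNorm_map_of, h0, map_zero] at ht
      have h1 := eq_zero_of_matNorm_eq_zero n _ (le_antisymm ht (apply_nonneg _ _))
      refine ⟨k, t, free_hom_ext (Matrix.ext fun a b => ?_)⟩
      have h2 := congrFun (congrFun h1 a) b
      simp only [hx, Matrix.map_apply, Matrix.sub_apply, map_sub, Matrix.zero_apply] at h2
      exact sub_eq_zero.1 h2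

end OS

theorem mainTheorem1 : IsLocallyCountablyPresentable.{u + 1, u, u} OS.{u} := by
  refine (IsCardinalLocallyPresentable.iff_exists_isStrongGenerator OS.{u} ℵ₁).2
    ⟨OS.frees, inferInstance, OS.isStrongGenerator_frees, ?_⟩
  rintro _ ⟨n⟩
  exact OS.isCardinalPresentable_free n.down
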